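/- All compactifications are Hausdorff: a compactification of a topological space $X$ is a compact Hausdorff space $Z$ containing $X$ as a dense subspace. Let $K(X)$ be the space of nonempty compact subsets of $X$ with the Vietoris topology. A space $Y$ is Menger if for every sequence $(\mathcal U_n)_{n\in\mathbb N}$ of open covers of $Y$ there are finite $\mathcal V_n\subseteq\mathcal U_n$ such that $\bigcup_n\mathcal V_n$ covers $Y$; $X$ is Menger at infinity if $Z\setminus X$ is Menger for some compactification $Z$ of $X$; a space is hereditarily Baire if each of its closed subspaces is a Baire space. Let $X$ be a topological space. (1) If $K(X)$ is first-countable and regular and $X$ is Menger at infinity, then $K(X)$ is hereditarily Baire. (2) If $X$ is separable and metrizable, then $K(X)$ is hereditarily Baire if and only if $X$ is Menger at infinity. In this case the following conditions are also each equivalent to $K(X)$ being hereditarily Baire: for any given compactification $Z$ of $X$, that $Z\setminus X$ is Menger; that $Z\setminus X$ is Menger for some metrizable compactification $Z$ of $X$; for any given compact metrizable space $Z$ containing $X$ as a (not necessarily dense) subspace, that $Z\setminus X$ is Menger. -/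

import Mathlib

open Set Topology TopologicalSpace

universe u v

/-- A space is Menger if from every sequence of open covers one can choose finite subfamilies,
one from each cover, whose union is again a cover. -/
def MengerSpace (Y : Type*) [TopologicalSpace Y] : Prop :=
  ∀ U : ℕ → Set (Set Y), (∀ n, (∀ u ∈ U n, IsOpen u) ∧ ⋃₀ U n = univ) →
    ∃ V : ℕ → Set (Set Y), (∀ n, V n ⊆ U n ∧ (V n).Finite) ∧ ⋃ n, ⋃₀ V n = univ

/-- A space is hereditarily Baire if every closed subspace of it is a Baire space. -/
def HereditarilyBaire (Y : Type*) [TopologicalSpace Y] : Prop :=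
  ∀ C : Set Y, IsClosed C → BaireSpace C

/-- `e : X → Z` is a (Hausdorff) compactification of `X`: the space `Z` is compact Hausdorff and
`e` is a homeomorphic embedding with dense range. -/
structure IsCompactification {X : Type*} {Z : Type*} [TopologicalSpace X] [TopologicalSpace Z]
    (e : X → Z) : Prop where
  compactSpace : CompactSpace Z
  t2Space : T2Space Z
  isEmbedding : IsEmbedding e
  denseRange : DenseRange e

/-- `X` is Menger at infinity if some compactification of `X` has a Menger remainder.
Every point of a compactification of `X` is the limit of an ultrafilter on `X`, so all
compactifications of `X` occur, up to homeomorphism, in the universe of `X`. -/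
def MengerAtInfinity (X : Type u) [TopologicalSpace X] : Prop :=
  ∃ (Z : Type u) (_ : TopologicalSpace Z) (e : X → Z),
    IsCompactification e ∧ MengerSpace ↥(range e)ᶜ

/-!
The two directions both compare `K(X)` with the complement `S` of a copy of `X` in a compact
Hausdorff space `Z`.

*Menger implies hereditarily Baire*
(`IsMengerSet.hereditarilyBaire_nonemptyCompacts`). Hurewicz's theorem says that the player who
proposes open covers of a Menger set has no winning strategy in the Menger game; a form adapted to
increasing covers indexed by finite sequences is `IsMengerSet.exists_branch`. Let `C` be closed in
`K(X)` and `D n` dense open in `C`. Shrink a nonempty open subset of `C` step by step: the current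
position contains a compact set `q ⊆ X`, and the open subsets of `Z` whose closure misses `q` cover
`S`. When a finite subfamily is selected, move to a smaller nonempty open set of `C`, with closure
in `D n`, of compact sets that miss the closure of the selected part. If the selected parts cover
`S`, a cluster point of the positions in the compact space `K(Z)` misses `S`. So it belongs to
`K(X)`, hence to `C` and to every `D n`. This uses neither first countability nor density of `X`
in `Z`.

*Hereditarily Baire implies Menger*, for `Z` compact metric
(`not_hereditarilyBaire_nonemptyCompacts`). Suppose that `closure X \ X` is not Menger, as witnessed
by increasing open covers `{U n k | k}`. To every finite sequence `s` attach the closed set `Q s` of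
points of `closure X` that avoid the sets chosen along `s`, and a compact set `A s ⊆ X` that contains
the points of `Q s` missed by the whole next cover and a finite approximation of `Q s`, growing
along branches (`exists_compact_tree`). Then `A (k :: s)` converges to `A s` as `k → ∞` but is
different from it. Along a branch `f`, the sets accumulate at every point of `⋂ n, Q (f|n)`; one of
these points is not in `X`, so there is no limit in `K(X)`. Therefore the sets `A s` form a closed
countable subset of `K(X)` without isolated points, which is not a Baire space. Points outside
`closure X` form a `σ`-compact set and do not affect the Menger property.

*Other compactifications.* A separable metrizable `X` embeds in the Hilbert cube, to which the
previous paragraph applies; the Menger property then passes to the remainder of an arbitrary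
compactification along an upper semicontinuous compact-valued map
(`IsMengerSet.compl_range_of_isCompactification`).
-/

/-! ### Menger subsets of a space -/

/-- A subset `S` of a space is Menger, expressed through families of open subsets of the ambient
space that cover `S`; see `mengerSpace_coe_iff` for the comparison with the subspace topology. -/
def IsMengerSet {Z : Type*} [TopologicalSpace Z] (S : Set Z) : Prop :=
  ∀ U : ℕ → Set (Set Z), (∀ n, (∀ u ∈ U n, IsOpen u) ∧ S ⊆ ⋃₀ U n) →
    ∃ V : ℕ → Set (Set Z), (∀ n, V n ⊆ U n ∧ (V n).Finite) ∧ S ⊆ ⋃ n, ⋃₀ V n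

theorem mengerSpace_coe_iff {Z : Type*} [TopologicalSpace Z] {S : Set Z} :
    MengerSpace ↥S ↔ IsMengerSet S := by
  constructor
  · intro h U hU
    obtain ⟨V, hV, hcov⟩ := h (fun n => (fun u => ((↑) : S → Z) ⁻¹' u) '' U n) fun n => by
      refine ⟨?_, ?_⟩
      · rintro _ ⟨u, hu, rfl⟩
        exact ((hU n).1 u hu).preimage continuous_subtype_val
      · refine eq_univ_of_forall fun y => ?_
        obtain ⟨u, hu, hyu⟩ := (hU n).2 y.2
        exact ⟨_, ⟨u, hu, rfl⟩, hyu⟩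
    choose W hWU hWf hWV using fun n =>
      exists_subset_image_finite_and.1 ⟨V n, (hV n).1, (hV n).2, rfl⟩
    refine ⟨W, fun n => ⟨hWU n, hWf n⟩, fun y hy => ?_⟩
    have hyV : (⟨y, hy⟩ : S) ∈ ⋃ n, ⋃₀ V n := hcov ▸ mem_univ _
    obtain ⟨n, v, hv, hyv⟩ := mem_iUnion.1 hyV
    rw [hWV n] at hv
    obtain ⟨u, hu, rfl⟩ := hv
    exact mem_iUnion.2 ⟨n, u, hu, hyv⟩
  · intro h U hU
    obtain ⟨V, hV, hcov⟩ := h (fun n => {O | IsOpen O ∧ ((↑) : S → Z) ⁻¹' O ∈ U n}) fun n => by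
      refine ⟨fun u hu => hu.1, fun y hy => ?_⟩
      have hyU : (⟨y, hy⟩ : S) ∈ ⋃₀ U n := (hU n).2 ▸ mem_univ _
      obtain ⟨u, hu, hyu⟩ := hyU
      obtain ⟨O, hO, rfl⟩ := isOpen_induced_iff.1 ((hU n).1 u hu)
      exact ⟨O, ⟨hO, hu⟩, hyu⟩
    refine ⟨fun n => (fun u => ((↑) : S → Z) ⁻¹' u) '' V n,
      fun n => ⟨?_, (hV n).2.image _⟩, eq_univ_of_forall fun y => ?_⟩
    · rintro _ ⟨u, hu, rfl⟩
      exact ((hV n).1 hu).2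
    · obtain ⟨n, u, hu, hyu⟩ := mem_iUnion.1 (hcov y.2)
      exact mem_iUnion.2 ⟨n, _, ⟨u, hu, rfl⟩, hyu⟩

/-- A Menger set together with countably many compact sets is Menger: the `n`-th finite subfamily
can take care of the `n`-th compact set as well. -/
theorem IsMengerSet.union_iUnion_isCompact {Z : Type*} [TopologicalSpace Z] {S T : Set Z}
    (hS : IsMengerSet S) {H : ℕ → Set Z} (hH : ∀ n, IsCompact (H n)) (hHT : ∀ n, H n ⊆ T)
    (hT : T ⊆ S ∪ ⋃ n, H n) (hST : S ⊆ T) : IsMengerSet T := by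
  intro U hU
  obtain ⟨V, hV, hcov⟩ := hS U fun n => ⟨(hU n).1, hST.trans (hU n).2⟩
  choose W hWU hWf hW using fun n =>
    (hH n).elim_finite_subcover_image (b := U n) (c := id) (hU n).1
      (by simpa only [sUnion_eq_biUnion, id] using (hHT n).trans (hU n).2)
  refine ⟨fun n => V n ∪ W n,
    fun n => ⟨union_subset (hV n).1 (hWU n), (hV n).2.union (hWf n)⟩, fun y hy => ?_⟩
  rcases hT hy with hy | hy
  · obtain ⟨n, u, hu, hyu⟩ := mem_iUnion.1 (hcov hy)
    exact mem_iUnion.2 ⟨n, u, Or.inl hu, hyu⟩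
  · obtain ⟨n, hyn⟩ := mem_iUnion.1 hy
    obtain ⟨u, hu, hyu⟩ := mem_iUnion₂.1 (hW n hyn)
    exact mem_iUnion.2 ⟨n, u, Or.inr hu, hyu⟩

theorem exists_monotone_cover_of_countable {Z : Type*} {S : Set Z} {T : Set (Set Z)}
    (hT : T.Countable) (hST : S ⊆ ⋃₀ T) :
    ∃ V : ℕ → Set Z, Monotone V ∧ S ⊆ ⋃ k, V k ∧ ∀ k, ∃ F ⊆ T, F.Finite ∧ V k = ⋃₀ F := by
  rcases T.eq_empty_or_nonempty with rfl | hne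
  · exact ⟨fun _ => ∅, monotone_const, by simpa using hST, fun _ => ⟨∅, by simp⟩⟩
  obtain ⟨g, rfl⟩ := hT.exists_eq_range hne
  refine ⟨fun k => ⋃₀ (g '' Iic k), fun a b hab => sUnion_mono (image_mono (Iic_subset_Iic.2 hab)),
    fun y hy => ?_,
    fun k => ⟨g '' Iic k, image_subset_range _ _, (finite_Iic k).image g, rfl⟩⟩
  obtain ⟨_, ⟨k, rfl⟩, hyk⟩ := hST hy
  exact mem_iUnion.2 ⟨k, g k, ⟨k, mem_Iic.2 le_rfl, rfl⟩, hyk⟩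

theorem IsMengerSet.exists_monotone_cover {Z : Type*} [TopologicalSpace Z] {S : Set Z}
    (hS : IsMengerSet S) {U : Set (Set Z)} (hU : ∀ u ∈ U, IsOpen u) (hSU : S ⊆ ⋃₀ U) :
    ∃ V : ℕ → Set Z, Monotone V ∧ S ⊆ ⋃ k, V k ∧ ∀ k, ∃ F ⊆ U, F.Finite ∧ V k = ⋃₀ F := by
  obtain ⟨W, hW, hcov⟩ := hS (fun _ => U) fun _ => ⟨hU, hSU⟩
  obtain ⟨V, hV, hSV, hVF⟩ := exists_monotone_cover_of_countable (S := S) (T := ⋃ n, W n)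
    (countable_iUnion fun n => (hW n).2.countable) (by rwa [sUnion_iUnion])
  refine ⟨V, hV, hSV, fun k => ?_⟩
  obtain ⟨F, hF, h⟩ := hVF k
  exact ⟨F, hF.trans (iUnion_subset fun n => (hW n).1), h⟩

/-! ### Branches of the tree of finite sequences and Hurewicz's theorem -/

/-- A rule that extends every finite sequence by one term is followed by some branch. As in
`PiNat.res`, a finite sequence is a list whose head is its last term. -/
theorem exists_forall_eq_res (g : List ℕ → ℕ) : ∃ f : ℕ → ℕ, ∀ n, f n = g (PiNat.res f n) := by
  let s : ℕ → List ℕ := fun n => Nat.rec [] (fun _ l => g l :: l) n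
  have hs : ∀ n, PiNat.res (fun n => g (s n)) n = s n := by
    intro n
    induction n with
    | zero => rfl
    | succ n ih => rw [PiNat.res_succ, ih]
  exact ⟨fun n => g (s n), fun n => by rw [hs]⟩

theorem exists_res_length_eq (s : List ℕ) : ∃ f : ℕ → ℕ, PiNat.res f s.length = s := by
  induction s with
  | nil => exact ⟨0, rfl⟩
  | cons k s ih =>
    obtain ⟨f, hf⟩ := ih
    refine ⟨Function.update f s.length k, ?_⟩
    rw [List.length_cons, PiNat.res_succ, Function.update_self]
    congr 1
    refine Eq.trans ?_ hf
    rw [PiNat.res_eq_res]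
    intro m hm
    rw [Function.update_of_ne hm.ne]

/-- The union of the sets chosen along a finite sequence in a tree of covers. -/
def branchUnion {Z : Type*} (U : List ℕ → ℕ → Set Z) : List ℕ → Set Z
  | [] => ∅
  | k :: s => branchUnion U s ∪ U s k

/-- At a fixed level of a tree of increasing open covers, a whole neighbourhood of a given point is
contained in the union along `s` for all but finitely many sequences `s`. -/
theorem exists_finite_forall_subset_branchUnion {Z : Type*} [TopologicalSpace Z] {S : Set Z}
    {U : List ℕ → ℕ → Set Z} (hopen : ∀ s k, IsOpen (U s k)) (hmono : ∀ s, Monotone (U s))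
    (hcov : ∀ s, S ⊆ ⋃ k, U s k) {y : Z} (hy : y ∈ S) (n : ℕ) :
    ∃ F : Set (List ℕ), F.Finite ∧ ∃ O : Set Z, IsOpen O ∧ y ∈ O ∧
      ∀ s : List ℕ, s.length = n → s ∉ F → O ⊆ branchUnion U s := by
  induction n with
  | zero =>
    refine ⟨{[]}, finite_singleton _, univ, isOpen_univ, mem_univ y, fun s hs hsF => ?_⟩
    exact absurd (List.length_eq_zero_iff.1 hs) hsF
  | succ n ih =>
    obtain ⟨F, hF, O, hO, hyO, hOF⟩ := ih
    choose k hk using fun s => mem_iUnion.1 (hcov s hy)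
    refine ⟨⋃ s ∈ F, (fun j => j :: s) '' Iio (k s), hF.biUnion fun s _ => (finite_Iio _).image _,
      O ∩ ⋂ s ∈ F, U s (k s), hO.inter (hF.isOpen_biInter fun s _ => hopen s _),
      ⟨hyO, mem_iInter₂.2 fun s _ => hk s⟩, ?_⟩
    rintro (_ | ⟨j, s⟩) hs hsF
    · simp at hs
    by_cases hsF' : s ∈ F
    · have hj : k s ≤ j := by
        by_contra hlt
        exact hsF (mem_biUnion hsF' ⟨j, not_le.1 hlt, rfl⟩)
      exact fun z hz => Or.inr (hmono s hj (mem_iInter₂.1 hz.2 s hsF'))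
    · exact fun z hz => Or.inl (hOF s (by simpa using hs) hsF' hz.1)

theorem branchUnion_res_subset {Z : Type*} (U : List ℕ → ℕ → Set Z) (f : ℕ → ℕ) (n : ℕ) :
    branchUnion U (PiNat.res f n) ⊆ ⋃ m, U (PiNat.res f m) (f m) := by
  induction n with
  | zero => exact empty_subset _
  | succ n ih => exact union_subset ih (subset_iUnion (fun m => U (PiNat.res f m) (f m)) n)

/-- **Hurewicz's theorem** on the Menger game: a strategy that answers every finite sequence of
natural numbers with an increasing open cover of a Menger set is defeated along some branch. -/
theorem IsMengerSet.exists_branch {Z : Type*} [TopologicalSpace Z] {S : Set Z}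
    (hS : IsMengerSet S) {U : List ℕ → ℕ → Set Z} (hopen : ∀ s k, IsOpen (U s k))
    (hmono : ∀ s, Monotone (U s)) (hcov : ∀ s, S ⊆ ⋃ k, U s k) :
    ∃ f : ℕ → ℕ, S ⊆ ⋃ n, U (PiNat.res f n) (f n) := by
  obtain ⟨V, hV, hSV⟩ := hS
    (fun n => {O | IsOpen O ∧ ∃ F : Set (List ℕ), F.Finite ∧
      ∀ s : List ℕ, s.length = n + 1 → s ∉ F → O ⊆ branchUnion U s}) fun n => by
    refine ⟨fun O hO => hO.1, fun y hy => ?_⟩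
    obtain ⟨F, hF, O, hO, hyO, h⟩ :=
      exists_finite_forall_subset_branchUnion hopen hmono hcov hy (n + 1)
    exact ⟨O, ⟨hO, F, hF, h⟩, hyO⟩
  choose! F hF hFU using fun n O (hO : O ∈ V n) => ((hV n).1 hO).2
  -- Avoiding the finitely many bad sequences of every level is possible one term at a time.
  have hstep : ∀ s : List ℕ, ∃ k : ℕ, k :: s ∉ ⋃ O ∈ V s.length, F s.length O := by
    intro s
    by_contra! hall
    refine infinite_univ.image (f := fun k : ℕ => k :: s)
      (fun a _ b _ hab => (List.cons.inj hab).1) ?_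
    refine ((hV s.length).2.biUnion fun O hO => hF s.length O hO).subset ?_
    rintro _ ⟨k, -, rfl⟩
    exact hall k
  choose g hg using hstep
  obtain ⟨f, hf⟩ := exists_forall_eq_res g
  refine ⟨f, fun y hy => ?_⟩
  obtain ⟨n, O, hO, hyO⟩ := mem_iUnion.1 (hSV hy)
  refine branchUnion_res_subset U f (n + 1) (hFU n O hO _ (PiNat.res_length f (n + 1)) ?_ hyO)
  intro hmem
  have := hg (PiNat.res f n)
  rw [← hf, PiNat.res_length, ← PiNat.res_succ] at this
  exact this (mem_biUnion hO hmem)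

/-! ### A Menger remainder makes the hyperspace hereditarily Baire -/

theorem Topology.IsEmbedding.exists_nonemptyCompacts_image_eq {X Z : Type*} [TopologicalSpace X]
    [TopologicalSpace Z] {e : X → Z} (he : IsEmbedding e) {A : Set Z} (hA : IsCompact A)
    (hne : A.Nonempty) (hAe : A ⊆ range e) : ∃ K : NonemptyCompacts X, e '' K = A := by
  have himg : e '' (e ⁻¹' A) = A := image_preimage_eq_of_subset hAe
  exact ⟨⟨⟨e ⁻¹' A, he.isCompact_iff.2 (by rwa [himg])⟩,
    (show (e '' (e ⁻¹' A)).Nonempty by rwa [himg]).of_image⟩, himg⟩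

theorem IsMengerSet.exists_monotone_cover_disjoint_closure {Z : Type*} [TopologicalSpace Z]
    [T2Space Z] [RegularSpace Z] {S K : Set Z} (hS : IsMengerSet S) (hK : IsCompact K)
    (hSK : Disjoint S K) :
    ∃ V : ℕ → Set Z, Monotone V ∧ (∀ k, IsOpen (V k)) ∧ S ⊆ ⋃ k, V k ∧
      ∀ k, K ⊆ (closure (V k))ᶜ := by
  obtain ⟨V, hV, hSV, hVF⟩ := hS.exists_monotone_cover
    (U := {u | IsOpen u ∧ K ⊆ (closure u)ᶜ}) (fun u hu => hu.1) fun y hy => by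
      obtain ⟨u, hu, hyu, hcl⟩ := (hK.isClosed.isOpen_compl.mem_nhds
        (disjoint_left.1 hSK hy)) |> exists_mem_nhds_isClosed_subset
      refine ⟨interior u, ⟨isOpen_interior, ?_⟩, mem_interior_iff_mem_nhds.2 hu⟩
      exact subset_compl_comm.1 ((closure_minimal interior_subset hyu).trans hcl)
  refine ⟨V, hV, fun k => ?_, hSV, fun k => ?_⟩ <;> obtain ⟨F, hF, hfin, hk⟩ := hVF k <;> rw [hk]
  · exact isOpen_sUnion fun u hu => (hF hu).1
  · rw [hfin.closure_sUnion, compl_iUnion₂]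
    exact subset_iInter₂ fun u hu => (hF hu).2

/-- If the complement of a copy of `X` in a compact Hausdorff space is Menger, then `K(X)` is
hereditarily Baire. Given dense open sets in a closed `C ⊆ K(X)`, shrink a nonempty open set of `C`
step by step into them, at the same time avoiding the closures of open sets chosen from a cover of
the complement; by Hurewicz's theorem this can be done so that the avoided sets exhaust the
complement, and then every cluster point in the compact hyperspace `K(Z)` lies in `K(X)`. -/
theorem IsMengerSet.hereditarilyBaire_nonemptyCompacts {X Z : Type*} [TopologicalSpace X]
    [TopologicalSpace Z] [CompactSpace Z] [T2Space Z] {e : X → Z} (he : IsEmbedding e)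
    (hS : IsMengerSet (range e)ᶜ) : HereditarilyBaire (NonemptyCompacts X) := by
  intro C hC
  have : RegularSpace X := he.isInducing.regularSpace
  refine ⟨fun D hDo hDd => ?_⟩
  rw [dense_iff_inter_open]
  intro W hWo hWne
  -- Nonempty open subsets of `C` are the positions of the game.
  let State := {G : Set C // IsOpen G ∧ G.Nonempty}
  have hcover : ∀ G : State, ∃ V : ℕ → Set Z, Monotone V ∧ (∀ k, IsOpen (V k)) ∧
      (range e)ᶜ ⊆ ⋃ k, V k ∧
        ∀ k, ∃ q ∈ G.1, e '' (q : NonemptyCompacts X) ⊆ (closure (V k))ᶜ := by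
    rintro ⟨G, hG, q, hq⟩
    obtain ⟨V, h₁, h₂, h₃, h₄⟩ := hS.exists_monotone_cover_disjoint_closure
      (K := e '' (q : NonemptyCompacts X)) (q.1.isCompact.image he.continuous)
      (disjoint_compl_left.mono_right (image_subset_range _ _))
    exact ⟨V, h₁, h₂, h₃, fun k => ⟨q, hq, h₄ k⟩⟩
  choose V hVmono hVopen hVcov hV using hcover
  have hnext : ∀ (n : ℕ) (G : State) (k : ℕ), ∃ G' : State, closure G'.1 ⊆ G.1 ∩ D n ∧
      ∀ q ∈ G'.1, e '' (q : NonemptyCompacts X) ⊆ (closure (V G k))ᶜ := by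
    intro n G k
    obtain ⟨q, hqG, hqV⟩ := hV G k
    have hO : IsOpen (G.1 ∩ {q : C | e '' (q : NonemptyCompacts X) ⊆ (closure (V G k))ᶜ}) := by
      refine G.2.1.inter ?_
      simp_rw [image_subset_iff]
      exact (NonemptyCompacts.isOpen_subsets_of_isOpen
        (isClosed_closure.isOpen_compl.preimage he.continuous)).preimage continuous_subtype_val
    obtain ⟨p, hpO, hpD⟩ := (hDd n).inter_open_nonempty _ hO ⟨q, hqG, hqV⟩
    obtain ⟨G', hG', hcl, hsub⟩ := exists_mem_nhds_isClosed_subset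
      ((hO.inter (hDo n)).mem_nhds ⟨hpO, hpD⟩)
    have hcl' : closure (interior G') ⊆ G' := closure_minimal interior_subset hcl
    refine ⟨⟨interior G', isOpen_interior, p, mem_interior_iff_mem_nhds.2 hG'⟩,
      fun r hr => ?_, fun r hr => (hsub (interior_subset hr)).1.2⟩
    exact ⟨(hsub (hcl' hr)).1.1, (hsub (hcl' hr)).2⟩
  choose next hnext hnextV using hnext
  let st : List ℕ → State := fun l =>
    List.rec ⟨W, hWo, hWne⟩ (fun k s G => next s.length G k) l
  obtain ⟨f, hf⟩ := hS.exists_branch (U := fun s => V (st s)) (fun s => hVopen _)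
    (fun s => hVmono _) (fun s => hVcov _)
  let G : ℕ → State := fun n => st (PiNat.res f n)
  have hG : ∀ n, G (n + 1) = next n (G n) (f n) := fun n => by
    change next (PiNat.res f n).length (G n) (f n) = _
    rw [PiNat.res_length]
  have hGsub : ∀ n, closure (G (n + 1)).1 ⊆ (G n).1 ∩ D n := fun n => by
    rw [hG]; exact hnext _ _ _
  let j : C → NonemptyCompacts Z := fun q => q.1.map e he.continuous
  have hj : IsEmbedding j := he.nonemptyCompacts_map.comp .subtypeVal
  -- A cluster point of the positions in the compact space `K(Z)`.
  obtain ⟨L, hL⟩ : (⋂ n, closure (j '' (G n).1)).Nonempty := by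
    refine IsCompact.nonempty_iInter_of_sequence_nonempty_isCompact_isClosed _ (fun n => ?_)
      (fun n => ?_) isClosed_closure.isCompact fun n => isClosed_closure
    · exact closure_mono (image_mono (subset_closure.trans ((hGsub n).trans inter_subset_left)))
    · exact ((G n).2.2.image j).closure
  have hL' : ∀ n, L ∈ closure (j '' (G n).1) := mem_iInter.1 hL
  have hLrange : (L : Set Z) ⊆ range e := by
    rw [← disjoint_compl_right_iff_subset, disjoint_left]
    intro z hzL hz
    obtain ⟨n, hzn⟩ := mem_iUnion.1 (hf hz)
    have hsub : closure (j '' (G (n + 1)).1) ⊆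
        {K : NonemptyCompacts Z | (K : Set Z) ⊆ (V (G n) (f n))ᶜ} := by
      refine closure_minimal ?_
        (NonemptyCompacts.isClosed_subsets_of_isClosed (hVopen _ _).isClosed_compl)
      rintro _ ⟨q, hq, rfl⟩
      rw [hG] at hq
      exact (hnextV _ _ _ q hq).trans (compl_subset_compl.2 subset_closure)
    exact hsub (hL' (n + 1)) hzL hzn
  obtain ⟨K, rfl⟩ : ∃ K : NonemptyCompacts X, K.map e he.continuous = L := by
    obtain ⟨K, hK⟩ := he.exists_nonemptyCompacts_image_eq L.isCompact L.nonempty hLrange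
    exact ⟨K, NonemptyCompacts.ext hK⟩
  have hKC : K ∈ C := by
    have h0 := hL' 0
    rw [← mem_preimage (f := NonemptyCompacts.map e he.continuous)] at h0
    have himg : j '' (G 0).1 = NonemptyCompacts.map e he.continuous '' ((↑) '' (G 0).1) :=
      (image_image _ _ _).symm
    rw [himg, ← he.nonemptyCompacts_map.closure_eq_preimage_closure_image] at h0
    exact closure_minimal (Subtype.coe_image_subset _ _) hC h0
  have hK : ∀ n, (⟨K, hKC⟩ : C) ∈ closure (G n).1 := fun n => by
    rw [hj.closure_eq_preimage_closure_image]
    exact hL' n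
  exact ⟨⟨K, hKC⟩, (hGsub 0 (hK 1)).1, mem_iInter.2 fun n => (hGsub n (hK (n + 1))).2⟩

/-! ### A closed countable crowded subset of the hyperspace -/

section CompactTree

variable {Z : Type*}

/-- The points of `T` that avoid the sets `U i k` chosen along a finite sequence, where `k` is the
`i`-th term of the sequence. -/
def avoidSet (T : Set Z) (U : ℕ → ℕ → Set Z) : List ℕ → Set Z
  | [] => T
  | k :: s => avoidSet T U s \ U s.length k

/-- A positive number attached to a finite sequence that decreases to zero both along branches and
along the immediate successors of a sequence. -/
noncomputable def listRadius (s : List ℕ) : ℝ := 1 / ((s.length + s.sum : ℕ) + 1 : ℝ)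

theorem listRadius_pos (s : List ℕ) : 0 < listRadius s := Nat.one_div_pos_of_nat

theorem listRadius_anti {s t : List ℕ} (h : s.length + s.sum ≤ t.length + t.sum) :
    listRadius t ≤ listRadius s := Nat.one_div_le_one_div h

theorem listRadius_cons_le (k : ℕ) (s : List ℕ) : listRadius (k :: s) ≤ listRadius s :=
  listRadius_anti (by simp only [List.length_cons, List.sum_cons]; omega)

theorem listRadius_cons_mono {k j : ℕ} (h : k ≤ j) (s : List ℕ) :
    listRadius (j :: s) ≤ listRadius (k :: s) :=
  listRadius_anti (by simp only [List.length_cons, List.sum_cons]; omega)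

theorem tendsto_listRadius_cons (s : List ℕ) :
    Filter.Tendsto (fun k => listRadius (k :: s)) Filter.atTop (𝓝 0) := by
  refine squeeze_zero (fun k => (listRadius_pos _).le) (fun k => ?_)
    tendsto_one_div_add_atTop_nhds_zero_nat
  exact Nat.one_div_le_one_div (by simp only [List.length_cons, List.sum_cons]; omega)

theorem tendsto_listRadius_res (f : ℕ → ℕ) :
    Filter.Tendsto (fun n => listRadius (PiNat.res f n)) Filter.atTop (𝓝 0) := by
  refine squeeze_zero (fun k => (listRadius_pos _).le) (fun k => ?_)
    tendsto_one_div_add_atTop_nhds_zero_nat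
  exact Nat.one_div_le_one_div (by rw [PiNat.res_length]; omega)

variable {T : Set Z} {U : ℕ → ℕ → Set Z}

theorem isClosed_avoidSet [TopologicalSpace Z] (hT : IsClosed T) (hU : ∀ n k, IsOpen (U n k))
    (s : List ℕ) : IsClosed (avoidSet T U s) := by
  induction s with
  | nil => exact hT
  | cons k s ih => exact ih.sdiff (hU _ _)

theorem avoidSet_subset (s : List ℕ) : avoidSet T U s ⊆ T := by
  induction s with
  | nil => exact subset_rfl
  | cons k s ih => exact sdiff_subset.trans ih

theorem avoidSet_cons_anti (hmono : ∀ n, Monotone (U n)) {k j : ℕ} (h : k ≤ j) (s : List ℕ) :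
    avoidSet T U (j :: s) ⊆ avoidSet T U (k :: s) :=
  sdiff_subset_sdiff_right (hmono _ h)

theorem mem_avoidSet_res {f : ℕ → ℕ} {y : Z} (hyT : y ∈ T) (hy : ∀ n, y ∉ U n (f n)) (n : ℕ) :
    y ∈ avoidSet T U (PiNat.res f n) := by
  induction n with
  | zero => exact hyT
  | succ n ih =>
    rw [PiNat.res_succ]
    refine ⟨ih, ?_⟩
    rw [PiNat.res_length]
    exact hy n

/-- The neighbourhoods of `avoidSet T U (k :: s)` shrink, as `k → ∞`, to those points of
`avoidSet T U s` that no set of the next cover contains. -/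
theorem mem_avoidSet_of_forall_mem_cthickening [MetricSpace Z] (hT : IsClosed T)
    (hU : ∀ n k, IsOpen (U n k)) (hmono : ∀ n, Monotone (U n)) {s : List ℕ} {z : Z}
    (hz : ∀ k, z ∈ Metric.cthickening (listRadius (k :: s)) (avoidSet T U (k :: s))) :
    z ∈ avoidSet T U s ∩ ⋂ k, (U s.length k)ᶜ := by
  have hmem : ∀ k, z ∈ avoidSet T U (k :: s) := by
    intro k
    rw [← (isClosed_avoidSet hT hU (k :: s)).closure_eq, ← Metric.cthickening_zero,
      Metric.cthickening_eq_iInter_cthickening]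
    refine mem_iInter₂.2 fun ε hε => ?_
    obtain ⟨j, hj, hjk⟩ := (((tendsto_listRadius_cons s).eventually_le_const hε).and
      (Filter.eventually_ge_atTop k)).exists
    exact Metric.cthickening_mono hj _
      (Metric.cthickening_subset_of_subset _ (avoidSet_cons_anti hmono hjk s) (hz j))
  exact ⟨(hmem 0).1, mem_iInter.2 fun k => (hmem k).2⟩

/-- If `X` accumulates at every point of the compact set `Q` and `Q` is not contained in `X`, then
some finite subset of `X` approximates `Q` up to `ε` and contains a point outside the given compact
set `B ⊆ X`. -/
theorem exists_finite_approx [MetricSpace Z] {X Q B : Set Z} (hQ : IsCompact Q)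
    (hQX : Q ⊆ closure X) (hne : ¬ Q ⊆ X) (hB : IsCompact B) (hBX : B ⊆ X) {ε : ℝ} (hε : 0 < ε) :
    ∃ F ⊆ X, F.Finite ∧ F ⊆ Metric.cthickening ε Q ∧ (∀ z ∈ Q, ∃ x ∈ F, dist z x ≤ 2 * ε) ∧
      ¬ F ⊆ B := by
  have hnear : ∀ z ∈ Q, ∀ O : Set Z, IsOpen O → z ∈ O → ∃ x ∈ X, x ∈ O ∧ dist z x < ε := by
    intro z hz O hO hzO
    obtain ⟨x, ⟨hxO, hxz⟩, hx⟩ := mem_closure_iff.1 (hQX hz) (O ∩ Metric.ball z ε)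
      (hO.inter Metric.isOpen_ball) ⟨hzO, Metric.mem_ball_self hε⟩
    exact ⟨x, hx, hxO, by rwa [dist_comm]⟩
  have hmem : ∀ z ∈ Q, ∀ x, dist z x < ε → x ∈ Metric.cthickening ε Q := fun z hz x hzx =>
    Metric.mem_cthickening_of_dist_le x z ε Q hz (by rw [dist_comm]; exact hzx.le)
  choose! p hpX _ hp using fun z hz => hnear z hz univ isOpen_univ (mem_univ z)
  obtain ⟨N, hNQ, hN, hcov⟩ := hQ.finite_cover_balls hε
  obtain ⟨y, hyQ, hyX⟩ := not_subset.1 hne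
  obtain ⟨w, hwX, hwB, hyw⟩ := hnear y hyQ Bᶜ hB.isClosed.isOpen_compl fun h => hyX (hBX h)
  refine ⟨insert w (p '' N), insert_subset hwX ?_, (hN.image p).insert w,
    insert_subset (hmem y hyQ w hyw) ?_, fun z hz => ?_, fun h => hwB (h (mem_insert _ _))⟩
  · rintro _ ⟨z, hz, rfl⟩
    exact hpX z (hNQ hz)
  · rintro _ ⟨z, hz, rfl⟩
    exact hmem z (hNQ hz) _ (hp z (hNQ hz))
  · obtain ⟨x, hxN, hzx⟩ := mem_iUnion₂.1 (hcov hz)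
    refine ⟨p x, mem_insert_of_mem _ (mem_image_of_mem p hxN), ?_⟩
    have h₁ := hp x (hNQ hxN)
    have h₂ := dist_triangle z x (p x)
    have h₃ := Metric.mem_ball.1 hzx
    linarith

/-- Compact subsets of `X` indexed by the finite sequences, growing along branches, in such a way
that the sets at the immediate successors of `s` properly contain the set at `s` and converge to
it, while the union along a branch accumulates at all points of the closure of `X` that avoid the
sets chosen along the branch. -/
theorem exists_compact_tree [MetricSpace Z] [CompactSpace Z] {X : Set Z}
    (hU : ∀ n k, IsOpen (U n k)) (hcov : ∀ n, closure X \ X ⊆ ⋃ k, U n k)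
    (hne : ∀ s, ¬ avoidSet (closure X) U s ⊆ X) :
    ∃ A : List ℕ → Set Z, (∀ s, IsCompact (A s)) ∧ (∀ s, A s ⊆ X) ∧ (∀ s, (A s).Nonempty) ∧
      (∀ k s, A s ⊆ A (k :: s)) ∧ (∀ k s, A (k :: s) ≠ A s) ∧
      (∀ k s, A (k :: s) ⊆
        A s ∪ Metric.cthickening (listRadius (k :: s)) (avoidSet (closure X) U (k :: s))) ∧
      (∀ s, avoidSet (closure X) U s ∩ ⋂ k, (U s.length k)ᶜ ⊆ A s) ∧
      ∀ s, ∀ z ∈ avoidSet (closure X) U s, ∃ x ∈ A s, dist z x ≤ 2 * listRadius s := by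
  have hQ : ∀ s, IsClosed (avoidSet (closure X) U s) := isClosed_avoidSet isClosed_closure hU
  choose! F hFX hFfin hFQ hF hFB using fun (s : List ℕ) (B : Set Z) (hB : IsCompact B)
    (hBX : B ⊆ X) => exists_finite_approx (hQ s).isCompact (avoidSet_subset s) (hne s) hB hBX
      (listRadius_pos s)
  -- The points of `avoidSet _ U s` missed by the next cover; they lie in `X`, and including them in `A s` is
  -- what makes `A (k :: s)` converge to `A s`.
  let L : List ℕ → Set Z := fun s => avoidSet (closure X) U s ∩ ⋂ k, (U s.length k)ᶜ
  have hLX : ∀ s, L s ⊆ X := by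
    rintro s z ⟨hz, hzU⟩
    by_contra hzX
    obtain ⟨k, hk⟩ := mem_iUnion.1 (hcov s.length ⟨avoidSet_subset s hz, hzX⟩)
    exact mem_iInter.1 hzU k hk
  have hLc : ∀ s, IsCompact (L s) := fun s =>
    ((hQ s).inter (isClosed_iInter fun k => (hU _ k).isClosed_compl)).isCompact
  let step : List ℕ → Set Z → Set Z := fun s B => B ∪ L s ∪ F s B
  let A : List ℕ → Set Z := fun l => List.rec (step [] ∅) (fun k s B => step (k :: s) B) l
  have hA : ∀ s, IsCompact (A s) ∧ A s ⊆ X := by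
    have hstep : ∀ s B, IsCompact B ∧ B ⊆ X → IsCompact (step s B) ∧ step s B ⊆ X :=
      fun s B ⟨hB, hBX⟩ => ⟨(hB.union (hLc s)).union (hFfin s B hB hBX).isCompact,
        union_subset (union_subset hBX (hLX s)) (hFX s B hB hBX)⟩
    intro s
    induction s with
    | nil => exact hstep [] ∅ ⟨isCompact_empty, empty_subset X⟩
    | cons k s ih => exact hstep (k :: s) (A s) ih
  have hAstep : ∀ s, ∃ B, IsCompact B ∧ B ⊆ X ∧ A s = step s B := by
    rintro (_ | ⟨k, s⟩)
    · exact ⟨∅, isCompact_empty, empty_subset X, rfl⟩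
    · exact ⟨A s, (hA s).1, (hA s).2, rfl⟩
  refine ⟨A, fun s => (hA s).1, fun s => (hA s).2, fun s => ?_, fun k s => ?_, fun k s => ?_,
    fun k s => ?_, fun s => ?_, fun s z hz => ?_⟩
  · obtain ⟨B, hB, hBX, hs⟩ := hAstep s
    obtain ⟨x, hx, -⟩ := not_subset.1 (hFB s B hB hBX)
    exact ⟨x, hs ▸ Or.inr hx⟩
  · exact fun z hz => Or.inl (Or.inl hz)
  · intro heq
    exact hFB (k :: s) (A s) (hA s).1 (hA s).2 fun x hx => heq ▸ Or.inr hx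
  · refine union_subset (union_subset subset_union_left ?_)
      ((hFQ (k :: s) (A s) (hA s).1 (hA s).2).trans subset_union_right)
    exact inter_subset_left.trans ((Metric.self_subset_cthickening _).trans subset_union_right)
  · obtain ⟨B, -, -, hs⟩ := hAstep s
    exact hs ▸ fun z hz => Or.inl (Or.inr hz)
  · obtain ⟨B, hB, hBX, hs⟩ := hAstep s
    obtain ⟨x, hx, hzx⟩ := hF s B hB hBX z hz
    exact ⟨x, hs ▸ Or.inr hx, hzx⟩

end CompactTree

/-- A nonempty countable T₁ space without isolated points is not a Baire space. -/
theorem not_baireSpace_of_countable {Y : Type*} [TopologicalSpace Y] [T1Space Y] [Countable Y]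
    [Nonempty Y] (h : ∀ y : Y, ¬ IsOpen {y}) : ¬ BaireSpace Y := by
  intro _
  obtain ⟨y, hy⟩ := nonempty_interior_of_iUnion_of_closed (f := fun y : Y => {y})
    (fun y => isClosed_singleton) (iUnion_of_singleton Y)
  rcases subset_singleton_iff_eq.1 (interior_subset : interior {y} ⊆ {y}) with h0 | h1
  · exact hy.ne_empty h0
  · exact h y (h1 ▸ isOpen_interior)

/-- In a compact metric space containing a copy of `X`, if some sequence of increasing open covers
of `closure X \ X` admits no selection of one member from each that still covers, then `K(X)` is
not hereditarily Baire: the compact sets of `exists_compact_tree` form a closed countable subset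
of `K(X)` without isolated points. It is closed because a limit of sets of the tree that is not one
of them is a limit along a branch, and hence contains points outside `X`. -/
theorem not_hereditarilyBaire_nonemptyCompacts {X Z : Type*} [TopologicalSpace X] [MetricSpace Z]
    [CompactSpace Z] {e : X → Z} (he : IsEmbedding e) {U : ℕ → ℕ → Set Z}
    (hU : ∀ n k, IsOpen (U n k)) (hmono : ∀ n, Monotone (U n))
    (hcov : ∀ n, closure (range e) \ range e ⊆ ⋃ k, U n k)
    (hsel : ∀ f : ℕ → ℕ, ¬ closure (range e) \ range e ⊆ ⋃ n, U n (f n)) :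
    ¬ HereditarilyBaire (NonemptyCompacts X) := by
  have hbranch : ∀ f : ℕ → ℕ, ∃ y ∉ range e, ∀ n,
      y ∈ avoidSet (closure (range e)) U (PiNat.res f n) := by
    intro f
    obtain ⟨y, hy, hyU⟩ := not_subset.1 (hsel f)
    exact ⟨y, hy.2, mem_avoidSet_res hy.1 fun n hn => hyU (mem_iUnion.2 ⟨n, hn⟩)⟩
  obtain ⟨A, hAc, hAX, hAne, hAmono, hAstrict, hAsub, hLA, hAnet⟩ :=
    exists_compact_tree hU hcov fun s hs => by
      obtain ⟨f, hf⟩ := exists_res_length_eq s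
      obtain ⟨y, hyX, hy⟩ := hbranch f
      exact hyX (hs (hf ▸ hy s.length))
  set Q := avoidSet (closure (range e)) U
  choose K hK using fun s => he.exists_nonemptyCompacts_image_eq (hAc s) (hAne s) (hAX s)
  have : T2Space X := he.t2Space
  have hsuffix : ∀ s t, s <:+ t → A s ⊆ A t := by
    rintro s _ ⟨l, rfl⟩
    induction l with
    | nil => exact subset_rfl
    | cons m l ih => exact ih.trans (hAmono m _)
  have hcthick : ∀ k s t, (k :: s) <:+ t →
      A t ⊆ A s ∪ Metric.cthickening (listRadius (k :: s)) (Q (k :: s)) := by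
    rintro k s _ ⟨l, rfl⟩
    have key : Q (l ++ k :: s) ⊆ Q (k :: s) ∧
        listRadius (l ++ k :: s) ≤ listRadius (k :: s) ∧
        A (l ++ k :: s) ⊆ A s ∪ Metric.cthickening (listRadius (k :: s)) (Q (k :: s)) := by
      induction l with
      | nil => exact ⟨subset_rfl, le_rfl, hAsub k s⟩
      | cons m l ih =>
        obtain ⟨h₁, h₂, h₃⟩ := ih
        have h₁' : Q (m :: l ++ k :: s) ⊆ Q (k :: s) := sdiff_subset.trans h₁
        have h₂' := (listRadius_cons_le m (l ++ k :: s)).trans h₂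
        refine ⟨h₁', h₂', (hAsub m _).trans (union_subset h₃ (Subset.trans ?_ subset_union_right))⟩
        exact (Metric.cthickening_mono h₂' _).trans (Metric.cthickening_subset_of_subset _ h₁')
    exact key.2.2
  have hcthick_anti : ∀ s k j, k ≤ j →
      Metric.cthickening (listRadius (j :: s)) (Q (j :: s)) ⊆
        Metric.cthickening (listRadius (k :: s)) (Q (k :: s)) := fun s k j hkj =>
    (Metric.cthickening_mono (listRadius_cons_mono hkj s) _).trans
      (Metric.cthickening_subset_of_subset _ (avoidSet_cons_anti hmono hkj s))
  have hlim : ∀ s z, (∀ k, z ∈ Metric.cthickening (listRadius (k :: s)) (Q (k :: s))) → z ∈ A s :=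
    fun s z hz => hLA s (mem_avoidSet_of_forall_mem_cthickening isClosed_closure hU hmono hz)
  have hclosed_sub : ∀ F : Set Z, IsClosed F →
      IsClosed {M : NonemptyCompacts X | e '' (M : Set X) ⊆ F} := fun F hF => by
    simp_rw [image_subset_iff]
    exact NonemptyCompacts.isClosed_subsets_of_isClosed (hF.preimage he.continuous)
  have hclosed_sup : ∀ s, IsClosed {M : NonemptyCompacts X | A s ⊆ e '' (M : Set X)} := fun s => by
    simp_rw [← hK s, image_subset_image_iff he.injective]
    have : {M : NonemptyCompacts X | (K s : Set X) ⊆ M} =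
        ⋂ x ∈ (K s : Set X), {M : NonemptyCompacts X | ((M : Set X) ∩ {x}).Nonempty} := by
      ext M; simp [subset_def]
    rw [this]
    exact isClosed_biInter fun x _ =>
      NonemptyCompacts.isClosed_inter_nonempty_of_isClosed isClosed_singleton
  -- The sets of the subtree above `s`.
  let B : List ℕ → Set (NonemptyCompacts X) := fun s => K '' {t | s <:+ t}
  have hBsup : ∀ s, ∀ M ∈ closure (B s), A s ⊆ e '' (M : Set X) := by
    intro s
    refine closure_minimal ?_ (hclosed_sup s)
    rintro _ ⟨t, ht, rfl⟩
    change A s ⊆ e '' (K t : Set X)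
    rw [hK]
    exact hsuffix s t ht
  have hclosed : IsClosed (range K) := by
    rw [← closure_subset_iff_isClosed]
    intro M hM
    by_contra hMK
    -- If `M` is not a limit of any one subtree above an immediate successor of `s`, then it is a
    -- limit of sets above successors `j :: s` with `j` arbitrarily large, which forces `M = K s`.
    have hdich : ∀ s, M ∈ closure (B s) → ∃ k, M ∈ closure (B (k :: s)) := by
      intro s hMs
      by_contra! hno
      refine hMK ⟨s, NonemptyCompacts.ext (he.injective.image_injective ?_)⟩
      rw [hK]
      refine (hBsup s M hMs).antisymm ?_
      have hsub : ∀ k, e '' (M : Set X) ⊆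
          A s ∪ Metric.cthickening (listRadius (k :: s)) (Q (k :: s)) := by
        intro k
        have hsplit : B s ⊆ ({K s} ∪ ⋃ j ∈ Iio k, B (j :: s)) ∪ ⋃ j ∈ Ici k, B (j :: s) := by
          rintro _ ⟨t, ⟨l, rfl⟩, rfl⟩
          rcases l.eq_nil_or_concat' with rfl | ⟨l', j, rfl⟩
          · exact Or.inl (Or.inl rfl)
          · have hmem : K (l' ++ [j] ++ s) ∈ B (j :: s) := ⟨_, ⟨l', by simp⟩, rfl⟩
            rcases lt_or_ge j k with hj | hj
            · exact Or.inl (Or.inr (mem_biUnion hj hmem))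
            · exact Or.inr (mem_biUnion hj hmem)
        have hM' := closure_mono hsplit hMs
        rw [closure_union, closure_union, (finite_Iio k).closure_biUnion, closure_singleton] at hM'
        rcases hM' with (rfl | hM') | hM'
        · exact absurd ⟨s, rfl⟩ hMK
        · obtain ⟨j, -, hj⟩ := mem_iUnion₂.1 hM'
          exact absurd hj (hno j)
        · refine closure_minimal ?_ (hclosed_sub _
            ((hAc s).isClosed.union Metric.isClosed_cthickening)) hM'
          refine iUnion₂_subset fun j hj => ?_
          rintro _ ⟨t, ht, rfl⟩
          rw [mem_ofPred_eq, hK]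
          exact (hcthick j s t ht).trans (union_subset_union_right _ (hcthick_anti s k j hj))
      intro z hz
      by_contra hzA
      exact hzA (hlim s z fun k => (hsub k hz).resolve_left hzA)
    -- Hence `M` is a limit along a branch and contains a point outside `X`.
    choose! g hg using hdich
    obtain ⟨f, hf⟩ := exists_forall_eq_res g
    have hMf : ∀ n, M ∈ closure (B (PiNat.res f n)) := by
      intro n
      induction n with
      | zero =>
        have : B [] = range K := by
          simp only [B, List.nil_suffix, ofPred_true, image_univ]
        exact this ▸ hM
      | succ n ih =>
        rw [PiNat.res_succ, hf]
        exact hg _ ih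
    obtain ⟨y, hyX, hy⟩ := hbranch f
    refine hyX (image_subset_range e M ?_)
    rw [← (M.isCompact.image he.continuous).isClosed.closure_eq, Metric.mem_closure_iff]
    intro ε hε
    obtain ⟨n, hn⟩ := ((tendsto_listRadius_res f).eventually_lt_const (half_pos hε)).exists
    obtain ⟨x, hx, hyx⟩ := hAnet _ y (hy n)
    exact ⟨x, hBsup _ M (hMf n) hx, by linarith⟩
  have htendsto : ∀ s, Filter.Tendsto (fun k => K (k :: s)) Filter.atTop (𝓝 (K s)) := by
    intro s
    let : TopologicalSpace (Set X) := .vietoris X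
    refine NonemptyCompacts.isEmbedding_coe.isInducing.tendsto_nhds_iff.2
      (TopologicalSpace.tendsto_nhds_generateFrom_iff.2 ?_)
    rintro _ (⟨O, hO, rfl⟩ | ⟨O, hO, rfl⟩) hs
    · obtain ⟨O, hO', rfl⟩ := he.isInducing.isOpen_iff.1 hO
      have hsO : A s ⊆ O := by rw [← hK s, image_subset_iff]; exact hs
      obtain ⟨k, hk⟩ := exists_subset_nhds_of_isCompact
        (V := fun k => Metric.cthickening (listRadius (k :: s)) (Q (k :: s)))
        (directed_of_isDirected_le fun k j hkj => hcthick_anti s k j hkj)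
        (fun k => Metric.isClosed_cthickening.isCompact)
        (fun z hz => hO'.mem_nhds (hsO (hlim s z (mem_iInter.1 hz))))
      filter_upwards [Filter.eventually_ge_atTop k] with j hj
      change (K (j :: s) : Set X) ⊆ e ⁻¹' O
      rw [← image_subset_iff, hK]
      exact (hAsub j s).trans (union_subset hsO ((hcthick_anti s k j hj).trans hk))
    · refine Filter.Eventually.of_forall fun k => hs.mono (inter_subset_inter_left _ ?_)
      change (K s : Set X) ⊆ K (k :: s)
      rw [← image_subset_image_iff he.injective, hK, hK]
      exact hAmono k s
  intro hHB
  have : Countable (range K) := (countable_range K).to_subtype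
  have : Nonempty (range K) := ⟨⟨K [], mem_range_self _⟩⟩
  refine not_baireSpace_of_countable (Y := range K) ?_ (hHB _ hclosed)
  rintro ⟨_, s, rfl⟩ hopen
  obtain ⟨O, hO, hOs⟩ := isOpen_induced_iff.1 hopen
  have hsO : K s ∈ O := by
    have : (⟨K s, mem_range_self s⟩ : range K) ∈ ((↑) : range K → _) ⁻¹' O := hOs ▸ rfl
    exact this
  obtain ⟨k, hk⟩ := ((htendsto s).eventually (hO.mem_nhds hsO)).exists
  have hmem : (⟨K (k :: s), mem_range_self _⟩ : range K) ∈ ((↑) : range K → _) ⁻¹' O := hk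
  rw [hOs] at hmem
  have heq : K (k :: s) = K s := congrArg Subtype.val (mem_singleton_iff.1 hmem)
  exact hAstrict k s (by rw [← hK, ← hK, heq])

theorem HereditarilyBaire.isMengerSet_closure_diff {X Z : Type*} [TopologicalSpace X]
    [MetricSpace Z] [CompactSpace Z] {e : X → Z} (he : IsEmbedding e)
    (h : HereditarilyBaire (NonemptyCompacts X)) :
    IsMengerSet (closure (range e) \ range e) := by
  intro U hU
  have hmono : ∀ n, ∃ V : ℕ → Set Z, Monotone V ∧ closure (range e) \ range e ⊆ ⋃ k, V k ∧
      ∀ k, ∃ F ⊆ U n, F.Finite ∧ V k = ⋃₀ F := by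
    intro n
    obtain ⟨T, hT, hTU, hTe⟩ := isOpen_sUnion_countable (U n) (hU n).1
    obtain ⟨V, hV, hcov, hVF⟩ := exists_monotone_cover_of_countable hT (hTe ▸ (hU n).2)
    refine ⟨V, hV, hcov, fun k => ?_⟩
    obtain ⟨F, hF, hfin⟩ := hVF k
    exact ⟨F, hF.trans hTU, hfin⟩
  choose V hVmono hVcov F hFU hFfin hVF using hmono
  have hVopen : ∀ n k, IsOpen (V n k) := fun n k => by
    rw [hVF]
    exact isOpen_sUnion fun u hu => (hU n).1 u (hFU n k hu)
  by_contra! hno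
  refine not_hereditarilyBaire_nonemptyCompacts he hVopen hVmono hVcov (fun f hf => ?_) h
  refine hno (fun n => F n (f n)) (fun n => ⟨hFU n _, hFfin n _⟩) ?_
  simpa only [hVF] using hf

/-! ### Independence of the ambient compact space -/

/-- For a copy of `X` in a compact metrizable space, `K(X)` is hereditarily Baire if and only if
the complement of the copy is Menger. The points outside the closure of the copy do not matter,
since they form a `σ`-compact set. -/
theorem hereditarilyBaire_nonemptyCompacts_iff_isMengerSet {X Z : Type*} [TopologicalSpace X]
    [TopologicalSpace Z] [CompactSpace Z] [MetrizableSpace Z] {e : X → Z} (he : IsEmbedding e) :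
    HereditarilyBaire (NonemptyCompacts X) ↔ IsMengerSet (range e)ᶜ := by
  refine ⟨fun h => ?_, fun h => h.hereditarilyBaire_nonemptyCompacts he⟩
  let := metrizableSpaceMetric Z
  obtain ⟨H, hHc, hHsub, hHU, -⟩ :=
    (isClosed_closure (s := range e)).isOpen_compl.exists_iUnion_isClosed
  refine (h.isMengerSet_closure_diff he).union_iUnion_isCompact (fun n => (hHc n).isCompact)
    (fun n => (hHsub n).trans (compl_subset_compl.2 subset_closure)) (fun z hz => ?_)
    fun z hz => hz.2
  by_cases hzc : z ∈ closure (range e)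
  · exact Or.inl ⟨hzc, hz⟩
  · exact Or.inr (hHU ▸ hzc)

/-- A limit point of the graph of the correspondence between two copies of `X` which lies over a
point of the second copy is the pair formed by that point and its counterpart. -/
theorem eq_of_mem_closure_range_prodMk {X Y Z : Type*} [TopologicalSpace X] [TopologicalSpace Y]
    [TopologicalSpace Z] [T2Space Y] {a : X → Y} {b : X → Z} (ha : Continuous a)
    (hb : IsInducing b) {y : Y} {x : X} (h : (y, b x) ∈ closure (range fun x => (a x, b x))) :
    y = a x := by
  have hne : (Filter.comap (fun x => (a x, b x)) (𝓝 (y, b x))).NeBot := by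
    refine Filter.comap_neBot_iff.2 fun t ht => ?_
    obtain ⟨_, hxt, x, rfl⟩ := mem_closure_iff_nhds.1 h t ht
    exact ⟨x, hxt⟩
  have ht := Filter.tendsto_comap (f := fun x => (a x, b x)) (x := 𝓝 (y, b x))
  rw [nhds_prod_eq] at ht hne
  exact tendsto_nhds_unique (Filter.tendsto_fst.comp ht)
    ((ha.tendsto x).comp (hb.tendsto_nhds_iff.2 (Filter.tendsto_snd.comp ht)))

/-- If the complement of a copy of `X` in some compact Hausdorff space is Menger, then so is the
remainder of every compactification `Z` of `X`: sending a point of the complement to its fibre in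
the closure of the graph defines an upper semicontinuous map whose values are compact subsets of
the remainder of `Z` and cover it. -/
theorem IsMengerSet.compl_range_of_isCompactification {X Y Z : Type*} [TopologicalSpace X]
    [TopologicalSpace Y] [TopologicalSpace Z] [CompactSpace Y] [T2Space Y] {a : X → Y} {b : X → Z}
    (ha : IsEmbedding a) (hb : IsCompactification b) (h : IsMengerSet (range a)ᶜ) :
    IsMengerSet (range b)ᶜ := by
  have := hb.compactSpace
  have := hb.t2Space
  set P : Set (Y × Z) := closure (range fun x => (a x, b x))
  have hPc : IsClosed P := isClosed_closure
  have hPa : ∀ x z, (a x, z) ∈ P → z = b x := by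
    intro x z hxz
    refine eq_of_mem_closure_range_prodMk hb.isEmbedding.continuous ha.isInducing ?_
    refine map_mem_closure (f := Prod.swap) continuous_swap hxz ?_
    rintro _ ⟨x, rfl⟩
    exact ⟨x, rfl⟩
  have hPb : ∀ y x, (y, b x) ∈ P → y = a x := fun y x hyx =>
    eq_of_mem_closure_range_prodMk ha.continuous hb.isEmbedding.isInducing hyx
  have hPsurj : ∀ z, ∃ y, (y, z) ∈ P := by
    intro z
    have hcl : IsClosed (Prod.snd '' P) := (hPc.isCompact.image continuous_snd).isClosed
    have hz : z ∈ Prod.snd '' P := by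
      refine closure_minimal ?_ hcl (hb.denseRange z)
      rintro _ ⟨x, rfl⟩
      exact ⟨_, subset_closure ⟨x, rfl⟩, rfl⟩
    obtain ⟨⟨y, _⟩, hy, rfl⟩ := hz
    exact ⟨y, hy⟩
  intro U hU
  have hopen : ∀ O : Set Z, IsOpen O → IsOpen {y | ∀ z, (y, z) ∈ P → z ∈ O} := by
    intro O hO
    have : {y | ∀ z, (y, z) ∈ P → z ∈ O} = (Prod.fst '' (P ∩ Prod.snd ⁻¹' Oᶜ))ᶜ := by
      ext y
      simp [not_and]
    rw [this, isOpen_compl_iff]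
    exact ((hPc.inter (hO.isClosed_compl.preimage continuous_snd)).isCompact.image
      continuous_fst).isClosed
  obtain ⟨V, hV, hcov⟩ := h (fun n => {W | ∃ F ⊆ U n, F.Finite ∧
      W = {y | ∀ z, (y, z) ∈ P → z ∈ ⋃₀ F}}) fun n => by
    refine ⟨?_, fun y hy => ?_⟩
    · rintro _ ⟨F, hFU, -, rfl⟩
      exact hopen _ (isOpen_sUnion fun u hu => (hU n).1 u (hFU hu))
    · have hfib : IsCompact {z | (y, z) ∈ P} :=
        (hPc.preimage (Continuous.prodMk_right y)).isCompact
      have hsub : {z | (y, z) ∈ P} ⊆ ⋃ u ∈ U n, id u := by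
        simp only [id, ← sUnion_eq_biUnion]
        refine Subset.trans ?_ (hU n).2
        rintro _ hz ⟨x, rfl⟩
        exact hy ⟨x, (hPb y x hz).symm⟩
      obtain ⟨F, hFU, hF, hcov⟩ := hfib.elim_finite_subcover_image (hU n).1 hsub
      exact ⟨_, ⟨F, hFU, hF, rfl⟩, fun z hz => by
        simpa only [sUnion_eq_biUnion, id] using hcov hz⟩
  choose! F hFU hF hVF using fun n W (hW : W ∈ V n) => (hV n).1 hW
  refine ⟨fun n => ⋃ W ∈ V n, F n W, fun n => ⟨iUnion₂_subset fun W hW => hFU n W hW,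
    (hV n).2.biUnion fun W hW => hF n W hW⟩, fun z hz => ?_⟩
  obtain ⟨y, hyz⟩ := hPsurj z
  have hy : y ∈ (range a)ᶜ := by
    rintro ⟨x, rfl⟩
    exact hz ⟨x, (hPa x z hyz).symm⟩
  obtain ⟨n, W, hW, hyW⟩ := mem_iUnion.1 (hcov hy)
  rw [hVF n W hW] at hyW
  obtain ⟨u, hu, hzu⟩ := hyW z hyz
  exact mem_iUnion.2 ⟨n, u, mem_biUnion hW hu, hzu⟩

/-! ### Metrizable compactifications -/

theorem exists_isEmbedding_hilbertCube (X : Type*) [TopologicalSpace X] [SeparableSpace X]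
    [MetrizableSpace X] : ∃ e : X → ℕ → unitInterval, IsEmbedding e :=
  let := metrizableSpaceMetric X
  Metric.PiNatEmbed.exists_embedding_to_hilbert_cube

theorem exists_metrizable_isCompactification (X : Type u) [TopologicalSpace X] [SeparableSpace X]
    [MetrizableSpace X] : ∃ (Z : Type u) (_ : TopologicalSpace Z) (e : X → Z),
      MetrizableSpace Z ∧ IsCompactification e := by
  obtain ⟨e, he⟩ := exists_isEmbedding_hilbertCube X
  have hcomp : CompactSpace (closure (range e)) :=
    isCompact_iff_compactSpace.1 isClosed_closure.isCompact
  have hmem : ∀ x, e x ∈ closure (range e) := fun x => subset_closure ⟨x, rfl⟩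
  refine ⟨ULift.{u} (closure (range e)), inferInstance, fun x => ⟨⟨e x, hmem x⟩⟩,
    Homeomorph.ulift.isEmbedding.metrizableSpace,
    Homeomorph.ulift.symm.compactSpace, inferInstance, ?_, ?_⟩
  · exact Homeomorph.ulift.symm.isEmbedding.comp (he.codRestrict _ hmem)
  · refine Homeomorph.ulift.symm.surjective.denseRange.comp
      (f := codRestrict e (closure (range e)) hmem) ?_ Homeomorph.ulift.symm.continuous
    rw [DenseRange, Subtype.dense_iff]
    intro z hz
    rwa [← range_comp]

/-! ### Hereditarily Baire hyperspaces and Menger remainders -/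

/-- `NonemptyCompacts X` is the space `K(X)` with Mathlib's Vietoris topology. -/
theorem corollary3p4 (X : Type u) [TopologicalSpace X] :
    (FirstCountableTopology (NonemptyCompacts X) → RegularSpace (NonemptyCompacts X) →
      MengerAtInfinity X → HereditarilyBaire (NonemptyCompacts X)) ∧
    (SeparableSpace X → MetrizableSpace X →
      (HereditarilyBaire (NonemptyCompacts X) ↔ MengerAtInfinity X) ∧
      (∀ (Z : Type v) [TopologicalSpace Z] (e : X → Z), IsCompactification e →
        (HereditarilyBaire (NonemptyCompacts X) ↔ MengerSpace ↥(range e)ᶜ)) ∧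
      (HereditarilyBaire (NonemptyCompacts X) ↔
        ∃ (Z : Type u) (_ : TopologicalSpace Z) (e : X → Z),
          MetrizableSpace Z ∧ IsCompactification e ∧ MengerSpace ↥(range e)ᶜ) ∧
      (∀ (Z : Type v) [TopologicalSpace Z] [CompactSpace Z] [MetrizableSpace Z] (e : X → Z),
        IsEmbedding e →
        (HereditarilyBaire (NonemptyCompacts X) ↔ MengerSpace ↥(range e)ᶜ))) := by
  simp only [MengerAtInfinity, mengerSpace_coe_iff]
  have hmp : ∀ (Z : Type u) (_ : TopologicalSpace Z) (e : X → Z), IsCompactification e →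
      IsMengerSet (range e)ᶜ → HereditarilyBaire (NonemptyCompacts X) := fun Z _ e he h =>
    have := he.compactSpace
    have := he.t2Space
    h.hereditarilyBaire_nonemptyCompacts he.isEmbedding
  refine ⟨fun _ _ ⟨Z, _, e, he, h⟩ => hmp Z _ e he h, fun _ _ => ?_⟩
  have hmetr : HereditarilyBaire (NonemptyCompacts X) →
      ∃ (Z : Type u) (_ : TopologicalSpace Z) (e : X → Z),
        MetrizableSpace Z ∧ IsCompactification e ∧ IsMengerSet (range e)ᶜ := by
    intro h
    obtain ⟨Z, _, e, hZ, he⟩ := exists_metrizable_isCompactification X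
    have := he.compactSpace
    exact ⟨Z, _, e, hZ, he,
      (hereditarilyBaire_nonemptyCompacts_iff_isMengerSet he.isEmbedding).1 h⟩
  refine ⟨⟨fun h => ?_, fun ⟨Z, _, e, he, h⟩ => hmp Z _ e he h⟩, fun Z _ e he => ⟨fun h => ?_,
    fun h => ?_⟩, ⟨hmetr, fun ⟨Z, _, e, _, he, h⟩ => hmp Z _ e he h⟩, fun Z _ _ _ e he =>
      hereditarilyBaire_nonemptyCompacts_iff_isMengerSet he⟩
  · obtain ⟨Z, _, e, -, he, hM⟩ := hmetr h
    exact ⟨Z, _, e, he, hM⟩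
  · obtain ⟨a, ha⟩ := exists_isEmbedding_hilbertCube X
    exact ((hereditarilyBaire_nonemptyCompacts_iff_isMengerSet ha).1
      h).compl_range_of_isCompactification ha he
  · have := he.compactSpace
    have := he.t2Space
    exact h.hereditarilyBaire_nonemptyCompacts he.isEmbedding
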